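/- Let $R$ be a regular local ring of (Krull) dimension $2$ with maximal ideal $\mathfrak m$, residue field $K=R/\mathfrak m$ and fraction field $\operatorname{Frac}(R)$. A \emph{prime divisor} of $R$ is a discrete valuation ring $V$ with $R\subseteq V\subseteq \operatorname{Frac}(R)$ and $\operatorname{Frac}(V)=\operatorname{Frac}(R)$ that dominates $R$ (its maximal ideal $\mathfrak m_V$ satisfies $\mathfrak m_V\cap R=\mathfrak m$) and whose residue field $V/\mathfrak m_V$ is a transcendental (i.e. non-algebraic) extension of $K$. For $z\in\operatorname{Frac}(R)$, $z\neq 0$, a \emph{dicritical divisor} of $z$ in $R$ is a prime divisor $V$ of $R$ such that $z\in V$ and the residue class of $z$ in $V/\mathfrak m_V$ is transcendental over $K$. Then every nonzero $z\in\operatorname{Frac}(R)$ has only finitely many dicritical divisors in $R$, and their number is $0$ if and only if $z\in R$ or $\frac1z\in R$. -/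

import Mathlib

namespace Dicritical

open IsLocalRing

variable {R : Type*} [CommRing R] [IsLocalRing R]
variable {F : Type*} [Field F] [Algebra R F]

/-- The canonical map `R → V` when the valuation ring `V` of `F` contains (the image of) `R`. -/
def toValuationRing (V : ValuationSubring F) (h : ∀ r : R, algebraMap R F r ∈ V) : R →+* V :=
  (algebraMap R F).codRestrict V h

variable (R) in
/-- The valuation ring `V` of `F` dominates the local ring `R`: it contains `R`, and the inclusion
`R → V` is a local homomorphism (the maximal ideal of `V` contracts to that of `R`). -/
structure Dominates (V : ValuationSubring F) : Prop where
  algebraMap_mem : ∀ r : R, algebraMap R F r ∈ V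
  isLocalHom : IsLocalHom (toValuationRing V algebraMap_mem)

/-- The extension of residue fields `R/𝔪 → V/𝔪_V` when `V` dominates `R`. -/
noncomputable def residueMap (V : ValuationSubring F) (h : Dominates R V) :
    ResidueField R →+* ResidueField V :=
  haveI := h.isLocalHom
  ResidueField.map (toValuationRing V h.algebraMap_mem)

variable (R) in
/-- `V` is a prime divisor of `R` (with `F` the fraction field of `R`): a discrete valuation ring
of `F` that dominates `R` and whose residue field extension is transcendental
(that is, not algebraic). -/
structure IsPrimeDivisor (V : ValuationSubring F) : Prop where
  isDiscreteValuationRing : IsDiscreteValuationRing V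
  dominates : Dominates R V
  transcendental :
    letI := (residueMap V dominates).toAlgebra
    Algebra.Transcendental (ResidueField R) (ResidueField V)

variable (R) in
/-- `V` is a dicritical divisor of `z` in `R`: a prime divisor of `R` that contains `z` and such
that the residue of `z` in `V/𝔪_V` is transcendental over `R/𝔪`. -/
structure IsDicriticalDivisor (z : F) (V : ValuationSubring F) : Prop where
  isPrimeDivisor : IsPrimeDivisor R V
  mem : z ∈ V
  transcendental_residue :
    letI := (residueMap V isPrimeDivisor.dominates).toAlgebra
    Transcendental (ResidueField R) (residue V ⟨z, mem⟩)

end Dicritical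

/-! If `z` or `1/z` is some `r` in `R`, then `X - r` or `rX - 1` vanishes at `z`, so the residue of
`z` is never transcendental. Otherwise, since `R` is factorial and hence normal, every polynomial
over `R` vanishing at `z` has all its coefficients in 𝔪 (`coeff_mem_maximalIdeal_of_aeval_eq_zero`).
Thus 𝔪R[X] contains the kernel of R[X] → F, and 𝔪R[z] is prime; let B be the localization of R[z]
there. The residue of `z` in V is transcendental exactly when f(z) ∈ 𝔪_V ⇔ f ∈ 𝔪R[X], which says
that V dominates B (`exists_subring_dominates_iff`).

As 𝔪R[X] has height 2 and the kernel is nonzero, dim B ≤ 1. By Krull–Akizuki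
(`isNoetherianRing_subalgebra`), each V dominating B is discrete, and the integral closure of B is
Dedekind with finitely many primes over 𝔪_B. Such a V is determined by its center there, whence
finiteness. Some V exists because every local subring of a field is dominated by a valuation ring.
-/

namespace Dicritical

open IsLocalRing Polynomial

/-! ### Factoriality of two-dimensional regular local rings -/

/-- In a Noetherian local ring whose maximal ideal is generated by `x` and `y`, a prime ideal
containing `x` but not `y` is generated by `x`. -/
theorem eq_span_singleton_of_maximalIdeal_eq_span_pair {R : Type*} [CommRing R] [IsLocalRing R]
    [IsNoetherianRing R] {x y : R} (hxy : maximalIdeal R = Ideal.span {x, y}) {q : Ideal R}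
    [hq : q.IsPrime] (hx : x ∈ q) (hy : y ∉ q) : q = Ideal.span {x} := by
  refine le_antisymm ?_ ((Ideal.span_singleton_le_iff_mem _).2 hx)
  -- By Nakayama, q ⊆ (x) + 𝔪q suffices.
  refine Submodule.le_of_le_smul_of_le_jacobson_bot (I := maximalIdeal R)
    (IsNoetherian.noetherian q) (maximalIdeal_le_jacobson _) fun w hw ↦ ?_
  have hw' := le_maximalIdeal hq.ne_top hw
  rw [hxy, Ideal.mem_span_pair] at hw'
  obtain ⟨a, b, rfl⟩ := hw'
  have hby : b * y ∈ q := by simpa using q.sub_mem hw (q.mul_mem_left a hx)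
  have hb : b ∈ q := (hq.mem_or_mem hby).resolve_right hy
  refine Submodule.add_mem_sup (Ideal.mem_span_singleton'.2 ⟨a, rfl⟩) ?_
  rw [mul_comm, smul_eq_mul]
  exact Ideal.mul_mem_mul (hxy ▸ Ideal.subset_span (by simp)) hb

/-- If `x` is in the maximal ideal of a Noetherian local ring `R` and `R / (x)` is a principal ideal
ring, then every prime ideal of `R` not containing `x` is principal. -/
theorem isPrincipal_of_isPrincipalIdealRing_quotient {R : Type*} [CommRing R] [IsLocalRing R]
    [IsNoetherianRing R] {x : R} (hx : x ∈ maximalIdeal R)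
    [IsPrincipalIdealRing (R ⧸ Ideal.span {x})] {p : Ideal R} [hp : p.IsPrime] (hxp : x ∉ p) :
    p.IsPrincipal := by
  let π := Ideal.Quotient.mk (Ideal.span {x})
  obtain ⟨g, hg⟩ := IsPrincipalIdealRing.principal (p.map π)
  have hg' : g ∈ p.map π := hg ▸ Submodule.mem_span_singleton_self g
  obtain ⟨f, hf, rfl⟩ := (Ideal.mem_map_iff_of_surjective π Ideal.Quotient.mk_surjective).1 hg'
  refine ⟨f, le_antisymm ?_ ((Ideal.span_singleton_le_iff_mem _).2 hf)⟩
  -- Nakayama again, with `f` lifting a generator of the image of p: `w - a * f = c * x` lies in p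
  -- and `x ∉ p`, so `c ∈ p`.
  refine Submodule.le_of_le_smul_of_le_jacobson_bot (I := maximalIdeal R)
    (IsNoetherian.noetherian p) (maximalIdeal_le_jacobson _) fun w hw ↦ ?_
  have hw' : π w ∈ Submodule.span (R ⧸ Ideal.span {x}) {π f} := hg ▸ Ideal.mem_map_of_mem π hw
  obtain ⟨a, ha⟩ := Submodule.mem_span_singleton.1 hw'
  obtain ⟨a, rfl⟩ := Ideal.Quotient.mk_surjective a
  rw [smul_eq_mul, ← map_mul, eq_comm, Ideal.Quotient.eq, Ideal.mem_span_singleton'] at ha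
  obtain ⟨c, hc⟩ := ha
  have hcx : c * x ∈ p := hc ▸ p.sub_mem hw (p.mul_mem_left a hf)
  have hcp : c ∈ p := (hp.mem_or_mem hcx).resolve_right hxp
  rw [← sub_add_cancel w (a * f), ← hc, add_comm]
  refine Submodule.add_mem_sup (Ideal.mem_span_singleton'.2 ⟨a, rfl⟩) ?_
  rw [mul_comm, smul_eq_mul]
  exact Ideal.mul_mem_mul hx hcp

/-- A two-dimensional regular local domain is factorial. -/
theorem uniqueFactorizationMonoid_of_ringKrullDim_eq_two {R : Type*} [CommRing R] [IsDomain R]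
    [IsRegularLocalRing R] (hdim : ringKrullDim R = 2) : UniqueFactorizationMonoid R := by
  have hrank : (maximalIdeal R).spanFinrank = 2 := by
    have := IsRegularLocalRing.spanFinrank_maximalIdeal (R := R)
    rw [hdim] at this
    exact_mod_cast this
  have hheight : (maximalIdeal R).height = 2 := by
    have := maximalIdeal_height_eq_ringKrullDim (R := R)
    rw [hdim] at this
    exact WithBot.coe_injective this
  obtain ⟨x, y, hxy⟩ : ∃ x y : R, maximalIdeal R = Ideal.span {x, y} := by
    have hfg : (maximalIdeal R).FG := IsNoetherian.noetherian _
    obtain ⟨x, y, -, h⟩ := Set.ncard_eq_two.1 ((Submodule.FG.generators_ncard hfg).trans hrank)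
    exact ⟨x, y, by rw [← h]; exact (Submodule.span_generators _).symm⟩
  have hxm : x ∈ maximalIdeal R := hxy ▸ Ideal.subset_span (by simp)
  obtain ⟨q, hq⟩ := Ideal.nonempty_minimalPrimes
    (I := Ideal.span {x}) (by rw [Ne, Ideal.span_singleton_eq_top]; exact hxm)
  have hqp : q.IsPrime := hq.1.1
  have hxq : x ∈ q := hq.1.2 (Ideal.mem_span_singleton_self x)
  -- Otherwise q = 𝔪 has height 2, against Krull's principal ideal theorem.
  have hyq : y ∉ q := fun hyq ↦ by
    have h1 : q = maximalIdeal R := le_antisymm (le_maximalIdeal hqp.ne_top) <| by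
      rw [hxy, Ideal.span_le]
      rintro _ (rfl | rfl) <;> assumption
    have h2 := Ideal.height_le_one_of_isPrincipal_of_mem_minimalPrimes (Ideal.span {x}) q hq
    rw [h1, hheight] at h2
    exact absurd h2 (by norm_num)
  have hqx := eq_span_singleton_of_maximalIdeal_eq_span_pair hxy hxq hyq
  have hx0 : x ≠ 0 := by
    rintro rfl
    have : (maximalIdeal R).height ≤ 1 := by
      rw [hxy, Ideal.span_insert_zero]
      refine Ideal.height_span_singleton_le_one fun hy ↦ ?_
      exact (maximalIdeal.isMaximal R).ne_top (by
        rw [hxy, Ideal.span_insert_zero, Ideal.span_singleton_eq_top]; exact hy)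
    rw [hheight] at this
    exact absurd this (by norm_num)
  have hxprime : Prime x := (Ideal.span_singleton_prime hx0).1 (hqx ▸ hqp)
  have : (Ideal.span {x}).IsPrime := hqx ▸ hqp
  have := IsLocalRing.of_surjective' (Ideal.Quotient.mk (Ideal.span {x}))
    Ideal.Quotient.mk_surjective
  have hpir : IsPrincipalIdealRing (R ⧸ Ideal.span {x}) := by
    have hmax : (maximalIdeal (R ⧸ Ideal.span {x})).IsPrincipal := by
      refine ⟨Ideal.Quotient.mk _ y, ?_⟩
      have : maximalIdeal (R ⧸ Ideal.span {x}) =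
          (maximalIdeal R).map (Ideal.Quotient.mk (Ideal.span {x})) :=
        (map_maximalIdeal_of_surjective _ Ideal.Quotient.mk_surjective).symm
      rw [this, hxy, Ideal.map_span, Set.image_pair,
        Ideal.Quotient.eq_zero_iff_mem.2 (Ideal.mem_span_singleton_self x), Ideal.span_insert_zero]
    exact ((tfae_of_isNoetherianRing_of_isLocalRing_of_isDomain (R ⧸ Ideal.span {x})).out 4 0).1
      hmax
  -- Kaplansky's criterion: every nonzero prime ideal contains a prime element.
  refine UniqueFactorizationMonoid.iff_exists_prime_mem_of_isPrime.2 fun p hp0 hp ↦ ?_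
  by_cases hxp : x ∈ p
  · exact ⟨x, hxp, hxprime⟩
  obtain ⟨f, hf⟩ := isPrincipal_of_isPrincipalIdealRing_quotient hxm hxp
  have hf' : p = Ideal.span {f} := hf
  have hf0 : f ≠ 0 := by
    rintro rfl
    exact hp0 (by simpa using hf')
  exact ⟨f, hf' ▸ Ideal.mem_span_singleton_self f, (Ideal.span_singleton_prime hf0).1 (hf' ▸ hp)⟩

/-! ### Polynomial relations of `z` -/

/-- Let `R` be an integrally closed local domain with fraction field `F`. If neither `z` nor `z⁻¹`
is in `R`, then all coefficients of a polynomial vanishing at `z` are in the maximal ideal. -/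
theorem coeff_mem_maximalIdeal_of_aeval_eq_zero {R F : Type*} [CommRing R] [IsDomain R]
    [IsLocalRing R] [IsIntegrallyClosed R] [Field F] [Algebra R F] [IsFractionRing R F] {z : F}
    (hz : z ∉ (algebraMap R F).range) (hz' : z⁻¹ ∉ (algebraMap R F).range) (f : R[X])
    (hf : aeval z f = 0) (i : ℕ) : f.coeff i ∈ maximalIdeal R := by
  have hz0 : z ≠ 0 := by
    rintro rfl
    exact hz (zero_mem _)
  obtain ⟨n, hn⟩ : ∃ n, f.natDegree ≤ n := ⟨_, le_rfl⟩
  induction n generalizing f i with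
  | zero =>
    obtain ⟨c, rfl⟩ := natDegree_eq_zero.1 (Nat.le_zero.1 hn)
    have : c = 0 := by simpa using hf
    simp [this]
  | succ n ih =>
    obtain hn | hn := Nat.le_succ_iff.1 hn
    · exact ih f hf i hn
    rw [Nat.succ_eq_add_one] at hn
    have hint : IsIntegral R (algebraMap R F (f.coeff (n + 1)) * z) := by
      simpa [leadingCoeff, hn, Algebra.smul_def] using isIntegral_leadingCoeff_smul f z hf
    obtain ⟨d, hd⟩ := IsIntegrallyClosed.isIntegral_iff.1 hint
    have hlead : f.coeff (n + 1) ∈ maximalIdeal R := by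
      by_contra h
      obtain ⟨u, hu⟩ := not_not.1 h
      refine hz ⟨↑u⁻¹ * d, ?_⟩
      rw [map_mul, hd, ← mul_assoc, ← map_mul, ← hu, Units.inv_mul, map_one, one_mul]
    have hd' : d ∈ maximalIdeal R := by
      by_contra h
      obtain ⟨u, hu⟩ := not_not.1 h
      refine hz' ⟨↑u⁻¹ * f.coeff (n + 1), eq_inv_of_mul_eq_one_left ?_⟩
      rw [map_mul, mul_assoc, ← hd, ← map_mul, ← hu, Units.inv_mul, map_one]
    -- The leading term at `z` equals `d * z ^ n`, so trading it for `C d * X ^ n` lowers the degree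
    -- and keeps the root. Only the coefficient at `n` changes, by `d ∈ 𝔪`.
    let g : R[X] := f.eraseLead + C d * X ^ n
    have hg : aeval z g = 0 := by
      have h1 := f.eraseLead_add_monomial_natDegree_leadingCoeff
      rw [leadingCoeff, hn, ← C_mul_X_pow_eq_monomial] at h1
      refine Eq.trans ?_ ((congrArg (aeval z) h1).trans hf)
      simp only [g, map_add, map_mul, aeval_C, map_pow, aeval_X, hd]
      ring
    have hgn : g.natDegree ≤ n := by
      refine natDegree_add_le_of_degree_le ?_ (natDegree_C_mul_X_pow_le d n)
      have := f.eraseLead_natDegree_le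
      omega
    have hgi := ih g hg i hgn
    obtain rfl | hi := eq_or_ne i (n + 1)
    · exact hlead
    rw [coeff_add, eraseLead_coeff_of_ne i (by omega), coeff_C_mul_X_pow] at hgi
    split_ifs at hgi with h
    · simpa using Ideal.sub_mem _ hgi hd'
    · simpa using hgi

/-! ### The Krull–Akizuki theorem -/

theorem eq_maximalIdeal_of_mem_of_ne_zero {B : Type*} [CommRing B] [IsLocalRing B]
    [Ring.DimensionLEOne B] {b : B} (hb0 : b ≠ 0) {p : Ideal B}
    [hp : p.IsPrime] (hbp : b ∈ p) : p = maximalIdeal B :=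
  eq_maximalIdeal (hp.isMaximal fun h ↦ hb0 (by simpa [h] using hbp))

theorem isArtinianRing_quotient_span_singleton {B : Type*} [CommRing B] [IsLocalRing B]
    [IsNoetherianRing B] [Ring.DimensionLEOne B] {b : B} (hb : b ∈ maximalIdeal B)
    (hb0 : b ≠ 0) : IsArtinianRing (B ⧸ Ideal.span {b}) := by
  refine IsLocalRing.quotient_artinian_of_mem_minimalPrimes_of_isLocalRing _
    ⟨⟨inferInstance, (Ideal.span_singleton_le_iff_mem _).2 hb⟩, fun q hq _ ↦ ?_⟩
  have := hq.1
  exact (eq_maximalIdeal_of_mem_of_ne_zero hb0 (hq.2 (Ideal.mem_span_singleton_self b))).ge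

theorem exists_dvd_pow_of_ne_zero {B : Type*} [CommRing B] [IsLocalRing B]
    [Ring.DimensionLEOne B] {b d : B} (hb : b ∈ maximalIdeal B)
    (hd : d ≠ 0) : ∃ m : ℕ, d ∣ b ^ m := by
  suffices b ∈ (Ideal.span {d}).radical by
    obtain ⟨m, hm⟩ := this
    exact ⟨m, Ideal.mem_span_singleton.1 hm⟩
  rw [Ideal.radical_eq_sInf, Ideal.mem_sInf]
  rintro p ⟨hdp, hp⟩
  rwa [eq_maximalIdeal_of_mem_of_ne_zero hd (hdp (Ideal.mem_span_singleton_self d))]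

/-- Every nonzero denominator divides a power of `b`, so F = B[1/b]. -/
theorem exists_algebraMap_eq_pow_mul {B F : Type*} [CommRing B] [IsLocalRing B]
    [Ring.DimensionLEOne B] [Field F] [Algebra B F] [IsFractionRing B F] (C : Subalgebra B F) {b : B}
    (hb : b ∈ maximalIdeal B) (x : C) :
    ∃ (m : ℕ) (r : B), algebraMap B C r = algebraMap B C b ^ m * x := by
  obtain ⟨c, d, hd, hx⟩ := IsFractionRing.div_surjective (A := B) (x : F)
  have hd0 := nonZeroDivisors.ne_zero hd
  obtain ⟨m, e, he⟩ := exists_dvd_pow_of_ne_zero hb hd0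
  have hd' : algebraMap B F d ≠ 0 := by simpa using hd0
  refine ⟨m, e * c, Subtype.ext ?_⟩
  rw [← map_pow, he]
  change algebraMap B F _ = algebraMap B F _ * (x : F)
  rw [← hx, map_mul, map_mul]
  field_simp

section KrullAkizuki

variable {B F : Type*} [CommRing B] [IsLocalRing B] [IsNoetherianRing B] [IsDomain B]
  [Ring.DimensionLEOne B] [Field F] [Algebra B F] [IsFractionRing B F] (C : Subalgebra B F)

/-- The key estimate in the Krull–Akizuki theorem: `C` is contained in `b⁻ᵗB + bC` for some `t`. -/
theorem exists_pow_mul_eq_algebraMap_add {b : B} (hb : b ∈ maximalIdeal B) (hb0 : b ≠ 0) :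
    ∃ t : ℕ, ∀ x : C, ∃ (r : B) (y : C),
      algebraMap B C b ^ t * x = algebraMap B C r + algebraMap B C b ^ (t + 1) * y := by
  have := isArtinianRing_quotient_span_singleton hb hb0
  let π := Ideal.Quotient.mk (Ideal.span {b})
  let β := algebraMap B C b
  have hβ : β ≠ 0 := by
    simpa [β] using hb0
  -- The ideals bⁿC ∩ B decrease, so their images in the Artinian ring B/(b) are constant from some
  -- `t` on.
  let I : ℕ → Ideal B := fun n ↦ (Ideal.span {β ^ n}).comap (algebraMap B C)
  have hI : Antitone I := fun m n hmn ↦ Ideal.comap_mono <|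
    Ideal.span_singleton_le_span_singleton.2 (pow_dvd_pow β hmn)
  let φ : ℕ →o (Ideal (B ⧸ Ideal.span {b}))ᵒᵈ :=
    ⟨fun n ↦ OrderDual.toDual ((I n).map π), fun m n hmn ↦ Ideal.map_mono (hI hmn)⟩
  obtain ⟨t, ht⟩ := IsArtinian.monotone_stabilizes φ
  have key (m : ℕ) : ∀ (x : C) (r : B), algebraMap B C r = β ^ m * x → ∃ (r : B) (y : C),
      β ^ t * x = algebraMap B C r + β ^ (t + 1) * y := by
    induction m with
    | zero =>
      intro x r hr
      exact ⟨b ^ t * r, 0, by simp [hr, β]⟩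
    | succ m ih =>
      intro x r hr
      obtain hmt | hmt := le_or_gt (m + 1) t
      · refine ⟨b ^ (t - (m + 1)) * r, 0, ?_⟩
        rw [map_mul, map_pow, hr, ← mul_assoc, ← pow_add, Nat.sub_add_cancel hmt, mul_zero,
          add_zero]
      -- Past `t`, `r` can be corrected by a multiple `s * b` to lie in b^(m+2)C; then `s` is b^m
      -- times `x - β * y`, and the exponent drops.
      have h1 : (I (m + 1)).map π = (I (m + 2)).map π :=
        (ht (m + 1) hmt.le).symm.trans (ht (m + 2) (by omega))
      have h2 : π r ∈ (I (m + 2)).map π := h1 ▸ Ideal.mem_map_of_mem π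
        (Ideal.mem_span_singleton'.2 ⟨x, by rw [hr, mul_comm]⟩)
      obtain ⟨r', hr', hrr'⟩ :=
        (Ideal.mem_map_iff_of_surjective π Ideal.Quotient.mk_surjective).1 h2
      obtain ⟨y, hy⟩ := Ideal.mem_span_singleton'.1 hr'
      rw [eq_comm, Ideal.Quotient.eq, Ideal.mem_span_singleton'] at hrr'
      obtain ⟨s, hs⟩ := hrr'
      have hs' : algebraMap B C s = β ^ m * (x - β * y) := by
        apply mul_right_cancel₀ hβ
        have := congrArg (algebraMap B C) hs
        rw [map_mul, map_sub, hr, ← hy] at this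
        rw [this]
        ring
      obtain ⟨r₁, y₁, h⟩ := ih _ s hs'
      refine ⟨r₁, y₁ + y, ?_⟩
      linear_combination h
  refine ⟨t, fun x ↦ ?_⟩
  obtain ⟨m, r, hr⟩ := exists_algebraMap_eq_pow_mul C hb x
  exact key m x r hr

/-- The elements of C that bᵗ multiplies into B form a B-module embedding in B, hence Noetherian; by
the key estimate it surjects onto C/bC. -/
theorem finite_quotient_span_singleton {b : B} (hb : b ∈ maximalIdeal B) (hb0 : b ≠ 0) :
    Module.Finite B (C ⧸ Ideal.span {algebraMap B C b}) := by
  obtain ⟨t, ht⟩ := exists_pow_mul_eq_algebraMap_add C hb hb0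
  let β := algebraMap B C b
  have hβ : β ≠ 0 := by
    simpa [β] using hb0
  let μ : C →ₗ[B] C := LinearMap.mulLeft B (β ^ t)
  have hμ : Function.Injective μ := fun x y h ↦ mul_left_cancel₀ (pow_ne_zero t hβ) h
  let N : Submodule B C := (LinearMap.range (Algebra.linearMap B C)).comap μ
  let g : N →ₗ[B] LinearMap.range (Algebra.linearMap B C) :=
    (μ.domRestrict N).codRestrict _ fun x ↦ x.2
  have hg : Function.Injective g := fun x y h ↦ Subtype.ext (hμ (congrArg Subtype.val h))
  have : IsNoetherian B N := isNoetherian_of_injective g hg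
  let f : N →ₗ[B] C ⧸ Ideal.span {β} :=
    (Ideal.Quotient.mkₐ B (Ideal.span {β})).toLinearMap ∘ₗ N.subtype
  refine Module.Finite.of_surjective f fun q ↦ ?_
  obtain ⟨x, rfl⟩ := Ideal.Quotient.mk_surjective q
  obtain ⟨r, y, h⟩ := ht x
  refine ⟨⟨x - β * y, r, ?_⟩, ?_⟩
  · change algebraMap B C r = β ^ t * (x - β * y)
    linear_combination -h
  · refine Ideal.Quotient.eq.2 (Ideal.mem_span_singleton'.2 ⟨-y, ?_⟩)
    change -y * β = x - β * y - x
    ring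

theorem isArtinianRing_subalgebra_quotient_span_singleton {b : B} (hb : b ∈ maximalIdeal B)
    (hb0 : b ≠ 0) : IsArtinianRing (C ⧸ Ideal.span {algebraMap B C b}) := by
  have := isArtinianRing_quotient_span_singleton hb hb0
  have := finite_quotient_span_singleton C hb hb0
  let J := Ideal.span {algebraMap B C b}
  have hJ : Ideal.span {b} ≤ J.comap (algebraMap B C) :=
    (Ideal.span_singleton_le_iff_mem _).2 (Ideal.mem_span_singleton_self _)
  let : Algebra (B ⧸ Ideal.span {b}) (C ⧸ J) := (Ideal.quotientMap J (algebraMap B C) hJ).toAlgebra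
  have : IsScalarTower B (B ⧸ Ideal.span {b}) (C ⧸ J) := .of_algebraMap_eq fun _ ↦ rfl
  have : Module.Finite (B ⧸ Ideal.span {b}) (C ⧸ J) := Module.Finite.of_restrictScalars_finite B _ _
  exact IsArtinianRing.of_finite (B ⧸ Ideal.span {b}) (C ⧸ J)

/-- The **Krull–Akizuki theorem** for local rings and subrings of the fraction field. -/
theorem isNoetherianRing_subalgebra : IsNoetherianRing C := by
  refine (isNoetherianRing_iff_ideal_fg C).2 fun J ↦ ?_
  obtain rfl | hJ := eq_or_ne J ⊥
  · exact Submodule.fg_bot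
  obtain ⟨x, hxJ, hx0⟩ := Submodule.exists_mem_ne_zero_of_ne_bot hJ
  -- A nonzero ideal of C meets B: take the numerator of `x`. Then C/cC is finite over B, which
  -- controls J modulo `c`.
  obtain ⟨c, hcJ, hc0⟩ : ∃ c : B, algebraMap B C c ∈ J ∧ c ≠ 0 := by
    obtain ⟨c, d, hd, hx⟩ := IsFractionRing.div_surjective (A := B) (x : F)
    have hd' : algebraMap B F d ≠ 0 := by simpa using nonZeroDivisors.ne_zero hd
    have h : algebraMap B C c = algebraMap B C d * x := by
      refine Subtype.ext ?_
      change algebraMap B F c = algebraMap B F d * x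
      rw [← hx]
      field_simp
    refine ⟨c, h ▸ J.mul_mem_left _ hxJ, ?_⟩
    rintro rfl
    rw [map_zero, zero_div] at hx
    exact hx0 (Subtype.ext hx.symm)
  by_cases hc : c ∈ maximalIdeal B
  · have := finite_quotient_span_singleton C hc hc0
    have : IsNoetherian C (C ⧸ Ideal.span {algebraMap B C c}) :=
      isNoetherian_of_tower B inferInstance
    refine Submodule.fg_of_fg_map_of_fg_inf_ker (Ideal.span {algebraMap B C c}).mkQ
      (IsNoetherian.noetherian _) ?_
    rw [Submodule.ker_mkQ, inf_eq_right.2 ((Ideal.span_singleton_le_iff_mem _).2 hcJ)]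
    exact Submodule.fg_span_singleton _
  · rw [J.eq_top_of_isUnit_mem hcJ ((not_not.1 hc).map _)]
    exact Module.Finite.fg_top

end KrullAkizuki

/-! ### Valuation rings dominating a one-dimensional local domain -/

theorem Dominates.mem_of_isIntegral {B F : Type*} [CommRing B] [Field F] [Algebra B F]
    {V : ValuationSubring F} (h : Dominates B V) {x : F}
    (hx : IsIntegral B x) : x ∈ V := by
  let : Algebra B V := (toValuationRing V h.algebraMap_mem).toAlgebra
  have : IsScalarTower B V F := .of_algebraMap_eq fun _ ↦ rfl
  obtain ⟨y, rfl⟩ := IsIntegrallyClosed.isIntegral_iff.1 (hx.tower_top (A := V))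
  exact y.2

/-- For two elements of a Dedekind domain, one divides the other up to a multiple prime to
a given nonzero prime ideal. -/
theorem exists_mul_eq_mul_or_of_isPrime {C : Type*} [CommRing C] [IsDedekindDomain C] {q : Ideal C}
    [q.IsPrime] (hq : q ≠ ⊥) (c d : C) :
    ∃ s e : C, s ∉ q ∧ (s * c = e * d ∨ s * d = e * c) := by
  have := IsLocalization.AtPrime.isDiscreteValuationRing_of_dedekind_domain C hq
    (Localization.AtPrime q)
  have key (c d : C) (hcd : algebraMap C (Localization.AtPrime q) d ∣ algebraMap C _ c) :
      ∃ s e : C, s ∉ q ∧ s * c = e * d := by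
    obtain ⟨w, hw⟩ := hcd
    obtain ⟨e, s, rfl⟩ := IsLocalization.exists_mk'_eq q.primeCompl w
    refine ⟨s, e, s.2, ?_⟩
    apply IsLocalization.injective (Localization.AtPrime q) q.primeCompl_le_nonZeroDivisors
    rw [map_mul, map_mul, hw, mul_comm, mul_assoc, IsLocalization.mk'_spec, mul_comm]
  obtain h | h := ValuationRing.dvd_total (algebraMap C (Localization.AtPrime q) d)
    (algebraMap C _ c)
  · obtain ⟨s, e, hs, h⟩ := key c d h
    exact ⟨s, e, hs, Or.inl h⟩
  · obtain ⟨s, e, hs, h⟩ := key d c h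
    exact ⟨s, e, hs, Or.inr h⟩

section Dominating

variable {B F : Type*} [CommRing B] [IsLocalRing B] [Field F] [Algebra B F]

theorem Dominates.valuation_lt_one {V : ValuationSubring F} (h : Dominates B V) {b : B}
    (hb : b ∈ maximalIdeal B) : V.valuation (algebraMap B F b) < 1 := by
  have := h.isLocalHom
  exact (V.valuation_lt_one_iff (toValuationRing V h.algebraMap_mem b)).1
    ((mem_maximalIdeal _).2 (map_mem_nonunits_iff _ b |>.2 hb))

theorem dominates_of_valuation_lt_one {V : ValuationSubring F}
    (hV : ∀ r : B, algebraMap B F r ∈ V)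
    (h : ∀ b ∈ maximalIdeal B, V.valuation (algebraMap B F b) < 1) : Dominates B V := by
  refine ⟨hV, ⟨fun b hb ↦ ?_⟩⟩
  by_contra hb'
  exact (V.valuation_lt_one_iff (toValuationRing V hV b)).2 (h b hb') hb

variable [IsNoetherianRing B] [IsDomain B] [Ring.DimensionLEOne B] [IsFractionRing B F]

/-- A valuation ring dominating a one-dimensional Noetherian local domain is discrete. -/
theorem Dominates.isDiscreteValuationRing {V : ValuationSubring F} (h : Dominates B V) {b : B}
    (hb : b ∈ maximalIdeal B) (hb0 : b ≠ 0) : IsDiscreteValuationRing V := by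
  let C : Subalgebra B F := { V.toSubring with algebraMap_mem' := h.algebraMap_mem }
  have : IsNoetherianRing V := isNoetherianRing_subalgebra C
  -- A Noetherian valuation ring is a principal ideal ring.
  have : IsPrincipalIdealRing V := inferInstance
  refine { not_a_field' := fun hbot ↦ hb0 ?_ }
  have hlt := h.valuation_lt_one hb
  have hmem := (V.valuation_lt_one_iff ⟨_, h.algebraMap_mem b⟩).2 hlt
  rw [hbot, Ideal.mem_bot] at hmem
  simpa using congrArg Subtype.val hmem

/-- A one-dimensional Noetherian local domain is dominated by only finitely many valuation rings of
its fraction field. -/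
theorem finite_setOf_dominates {b : B} (hb : b ∈ maximalIdeal B) (hb0 : b ≠ 0) :
    {V : ValuationSubring F | Dominates B V}.Finite := by
  let C := integralClosure B F
  let β := algebraMap B C b
  have hβ : β ≠ 0 := by simpa [β] using hb0
  have : IsNoetherianRing C := isNoetherianRing_subalgebra C
  have : IsFractionRing C F := integralClosure.isFractionRing_of_finite_extension F F
  have : IsIntegrallyClosed C := integralClosure.isIntegrallyClosedOfFiniteExtension F
  have : IsDedekindDomain C := {}
  have : IsArtinianRing (C ⧸ Ideal.span {β}) :=
    isArtinianRing_subalgebra_quotient_span_singleton C hb hb0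
  let π := Ideal.Quotient.mk (Ideal.span {β})
  have hfin : {p : Ideal C | p.IsPrime ∧ β ∈ p}.Finite := by
    refine ((IsArtinianRing.setOfPred_isPrime_finite (C ⧸ Ideal.span {β})).image
      (Ideal.comap π)).subset ?_
    rintro p ⟨hp, hβp⟩
    have hker : RingHom.ker π ≤ p := by
      rw [Ideal.mk_ker, Ideal.span_singleton_le_iff_mem]
      exact hβp
    refine ⟨p.map π, Ideal.map_isPrime_of_surjective Ideal.Quotient.mk_surjective hker, ?_⟩
    rw [Ideal.comap_map_of_surjective π Ideal.Quotient.mk_surjective]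
    exact sup_eq_left.2 hker
  -- The center of V on C, kept as a set so that it is defined for every V.
  let Q : ValuationSubring F → Set C := fun V ↦ {c | V.valuation (c : F) < 1}
  have hmem {V : ValuationSubring F} (hV : Dominates B V) (c : C) : V.valuation (c : F) ≤ 1 :=
    (V.valuation_le_one_iff _).2 (hV.mem_of_isIntegral c.2)
  have hQ {V : ValuationSubring F} (hV : Dominates B V) :
      ∃ p : Ideal C, p.IsPrime ∧ β ∈ p ∧ (p : Set C) = Q V := by
    let ι : C →+* V := C.toSubring.subtype.codRestrict V fun c ↦ hV.mem_of_isIntegral c.2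
    exact ⟨(maximalIdeal V).comap ι, inferInstance,
      (V.valuation_lt_one_iff (ι β)).2 (hV.valuation_lt_one hb),
      Set.ext fun c ↦ V.valuation_lt_one_iff (ι c)⟩
  refine Set.Finite.of_injOn (f := Q) (t := SetLike.coe '' {p : Ideal C | p.IsPrime ∧ β ∈ p})
    (fun V hV ↦ ?_) ?_ (hfin.image _)
  · obtain ⟨p, hp, hβp, hpV⟩ := hQ hV
    exact ⟨p, ⟨hp, hβp⟩, hpV⟩
  -- The center determines V: an element of V can be written as a fraction of elements of C with
  -- denominator outside the center, so it lies in W too.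
  have hle {V W : ValuationSubring F} (hV : Dominates B V) (hW : Dominates B W)
      (hVW : Q V = Q W) : V ≤ W := by
    intro x hx
    obtain ⟨p, hp, hβp, hpV⟩ := hQ hV
    obtain ⟨c, d, hd, rfl⟩ := IsFractionRing.div_surjective (A := C) x
    have hd0 : (d : F) ≠ 0 := by simpa using nonZeroDivisors.ne_zero hd
    have hunit {U : ValuationSubring F} (hU : Dominates B U) (hpU : (p : Set C) = Q U) {s : C}
        (hs : s ∉ p) : U.valuation (s : F) = 1 :=
      (hmem hU s).antisymm <| not_lt.1 fun h ↦ hs <| by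
        rwa [← SetLike.mem_coe, hpU]
    rw [← W.valuation_le_one_iff]
    rw [← V.valuation_le_one_iff] at hx
    obtain ⟨s, e, hs, h | h⟩ := exists_mul_eq_mul_or_of_isPrime (q := p)
      (fun h ↦ hβ (by simpa [h] using hβp)) c d
    · have hs' := hunit hW (hpV.trans hVW) hs
      have h' : (s : F) * ((c : F) / d) = e := by
        rw [← mul_div_assoc, div_eq_iff hd0]
        exact congrArg Subtype.val h
      have := congrArg W.valuation h'
      rw [map_mul, hs', one_mul] at this
      exact this.trans_le (hmem hW e)
    · have h' : (e : F) * ((c : F) / d) = s := by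
        rw [← mul_div_assoc, div_eq_iff hd0]
        exact congrArg Subtype.val h.symm
      have he : e ∉ p := fun he ↦ by
        have h1 := congrArg V.valuation h'
        rw [← SetLike.mem_coe, hpV] at he
        rw [map_mul, hunit hV hpV hs] at h1
        exact (mul_lt_one_of_lt_of_le he hx).ne h1
      have := congrArg W.valuation h'
      rw [map_mul, hunit hW (hpV.trans hVW) he, one_mul] at this
      exact this.trans_le (hmem hW s)
  exact fun V hV W hW h ↦ (hle hV hW h).antisymm (hle hW hV h.symm)

end Dominating

/-! ### Transcendental residues and the local ring B -/

theorem Dominates.aeval_mem {R F : Type*} [CommRing R] [Field F] [Algebra R F]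
    {V : ValuationSubring F} (h : Dominates R V) {z : F}
    (hz : z ∈ V) (f : R[X]) : aeval z f ∈ V := by
  rw [aeval_eq_sum_range]
  exact sum_mem fun i _ ↦ by
    rw [Algebra.smul_def]
    exact mul_mem (h.algebraMap_mem _) (pow_mem hz i)

section Residue

variable {R F : Type*} [CommRing R] [IsLocalRing R] [Field F] [Algebra R F]

theorem mem_map_C_maximalIdeal_iff (f : R[X]) :
    f ∈ (maximalIdeal R).map C ↔ f.map (residue R) = 0 := by
  rw [Ideal.mem_map_C_iff, Polynomial.ext_iff]
  exact forall_congr' fun n ↦ by rw [coeff_map, coeff_zero, residue_eq_zero_iff]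

theorem Dominates.eval₂_residue_map {V : ValuationSubring F} (h : Dominates R V) {z : F}
    (hz : z ∈ V) (f : R[X]) :
    (f.map (residue R)).eval₂ (residueMap V h) (residue V ⟨z, hz⟩) =
      residue V ⟨aeval z f, h.aeval_mem hz f⟩ := by
  have := h.isLocalHom
  have h1 : (⟨aeval z f, h.aeval_mem hz f⟩ : V) =
      f.eval₂ (toValuationRing V h.algebraMap_mem) ⟨z, hz⟩ := by
    refine Subtype.ext ?_
    change aeval z f = V.subtype _
    rw [hom_eval₂]
    rfl
  rw [h1, hom_eval₂, eval₂_map]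
  rfl

/-- Polynomials over the residue field lift to R[X], and 𝔪R[X] is the kernel of reduction. This
turns transcendence into a condition on the valuation alone. -/
theorem Dominates.transcendental_residue_iff {V : ValuationSubring F} (h : Dominates R V) {z : F}
    (hz : z ∈ V) :
    (letI := (residueMap V h).toAlgebra;
      Transcendental (ResidueField R) (residue V ⟨z, hz⟩)) ↔
    ∀ f : R[X], V.valuation (aeval z f) < 1 ↔ f ∈ (maximalIdeal R).map C := by
  let := (residueMap V h).toAlgebra
  have key (f : R[X]) : aeval (residue V ⟨z, hz⟩) (f.map (residue R)) = 0 ↔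
      V.valuation (aeval z f) < 1 := by
    rw [← V.valuation_lt_one_iff ⟨aeval z f, h.aeval_mem hz f⟩, ← residue_eq_zero_iff,
      ← h.eval₂_residue_map hz f]
    rfl
  refine ⟨fun H f ↦ ?_, fun H ↦ transcendental_iff.2 fun p hp ↦ ?_⟩
  · rw [← key, mem_map_C_maximalIdeal_iff]
    refine ⟨fun h ↦ transcendental_iff.1 H _ h, fun h ↦ by rw [h, map_zero]⟩
  · obtain ⟨f, rfl⟩ := map_surjective (residue R) residue_surjective p
    rwa [key, H, mem_map_C_maximalIdeal_iff] at hp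

end Residue

/-- Let `R` be a two-dimensional Noetherian integrally closed local domain. If neither `z` nor `z⁻¹`
is in `R`, then the localization of `R[z]` at the prime ideal `𝔪R[z]` is a one-dimensional
Noetherian local domain, and the valuation rings dominating it are those that dominate `R` and in
which the residue of `z` is transcendental. -/
theorem exists_subring_dominates_iff {R F : Type*} [CommRing R] [IsDomain R] [IsLocalRing R]
    [IsNoetherianRing R] [IsIntegrallyClosed R] [Field F] [Algebra R F] [IsFractionRing R F]
    (hdim : ringKrullDim R = 2) {z : F} (hz : z ∉ (algebraMap R F).range)
    (hz' : z⁻¹ ∉ (algebraMap R F).range) :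
    ∃ (B : Subring F) (_ : IsLocalRing B), IsNoetherianRing B ∧ Ring.DimensionLEOne B ∧
      IsFractionRing B F ∧ (∃ b ∈ maximalIdeal B, b ≠ 0) ∧
      ∀ V : ValuationSubring F, Dominates B V ↔ ∃ (h : Dominates R V) (hzV : z ∈ V),
        letI := (residueMap V h).toAlgebra
        Transcendental (ResidueField R) (residue V ⟨z, hzV⟩) := by
  let M : Ideal R[X] := (maximalIdeal R).map C
  have hM : M.IsPrime := Ideal.isPrime_map_C_of_isPrime
  have hker (f : R[X]) (hf : aeval z f = 0) : f ∈ M :=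
    Ideal.mem_map_C_iff.2 (coeff_mem_maximalIdeal_of_aeval_eq_zero hz hz' f hf)
  have hunit (g : M.primeCompl) : IsUnit ((aeval z : R[X] →ₐ[R] F) (g : R[X])) :=
    isUnit_iff_ne_zero.2 fun h ↦ g.2 (hker _ h)
  let L := Localization.AtPrime M
  let Φ : L →+* F := IsLocalization.lift (M := M.primeCompl)
    (g := (aeval z : R[X] →ₐ[R] F).toRingHom) hunit
  have hΦ (f : R[X]) : Φ (algebraMap R[X] L f) = aeval z f := IsLocalization.lift_eq _ _
  let B := Φ.range
  have hsurj : Function.Surjective Φ.rangeRestrict := Φ.rangeRestrict_surjective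
  have hlocal : IsLocalRing B := IsLocalRing.of_surjective' _ hsurj
  have hRB (r : R) : algebraMap R F r ∈ B := ⟨algebraMap R[X] L (C r), by rw [hΦ, aeval_C]⟩
  have hfrac : IsFractionRing B F := by
    refine IsFractionRing.of_field B F fun x ↦ ?_
    obtain ⟨a, c, -, rfl⟩ := IsFractionRing.div_surjective (A := R) x
    exact ⟨⟨_, hRB a⟩, ⟨_, hRB c⟩, rfl⟩
  have hnoeth : IsNoetherianRing B := isNoetherianRing_of_surjective L B _ hsurj
  have hBdim : Ring.KrullDimLE 1 B := by
    obtain ⟨a, c, hc, hac⟩ := IsFractionRing.div_surjective (A := R) z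
    have hc0 := nonZeroDivisors.ne_zero hc
    have hc0' : algebraMap R F c ≠ 0 := by simpa using hc0
    -- With z = a/c, this nonzero polynomial is in the kernel, so dim B + 1 ≤ height 𝔪R[X] = 2.
    let f : R[X] := C c * X - C a
    have hf0 : f ≠ 0 := fun h ↦ hc0 (by simpa [f] using congrArg (coeff · 1) h)
    have hf : aeval z f = 0 := by
      simp only [f, map_sub, map_mul, aeval_C, aeval_X, ← hac]
      field_simp
      ring
    have h1 := ringKrullDim_succ_le_of_surjective Φ.rangeRestrict hsurj
      (r := algebraMap R[X] L f)
      (mem_nonZeroDivisors_of_ne_zero fun h ↦ hf0 <|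
        IsLocalization.injective L M.primeCompl_le_nonZeroDivisors (h.trans (map_zero _).symm))
      (Subtype.ext ((hΦ f).trans hf))
    rw [IsLocalization.AtPrime.ringKrullDim_eq_height M L, height_map_C,
      maximalIdeal_height_eq_ringKrullDim, hdim] at h1
    rw [Ring.krullDimLE_iff]
    have h2 : ringKrullDim B + 1 ≤ 1 + 1 := h1
    exact ENat.WithBot.add_le_add_one_right_iff.1 h2
  have hBdim' : Ring.DimensionLEOne B :=
    ⟨fun {p} h0 hp ↦ Ring.krullDimLE_one_iff_of_noZeroDivisors.1 hBdim p h0 hp⟩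
  have hloc : IsLocalHom Φ.rangeRestrict := .of_surjective _ hsurj
  have hmem (f : R[X]) : aeval z f ∈ B := ⟨algebraMap R[X] L f, hΦ f⟩
  have hmap (f : R[X]) : Φ.rangeRestrict (algebraMap R[X] L f) = ⟨aeval z f, hmem f⟩ :=
    Subtype.ext (hΦ f)
  have hmax (f : R[X]) : (⟨aeval z f, hmem f⟩ : B) ∈ maximalIdeal B ↔ f ∈ M := by
    rw [← hmap, mem_maximalIdeal, map_mem_nonunits_iff, ← mem_maximalIdeal,
      IsLocalization.AtPrime.to_map_mem_maximal_iff L M]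
  refine ⟨B, hlocal, hnoeth, hBdim', hfrac, ?_, fun V ↦ ?_⟩
  · obtain ⟨r, hr, hr0⟩ : ∃ r ∈ maximalIdeal R, r ≠ 0 := by
      refine Submodule.exists_mem_ne_zero_of_ne_bot fun h ↦ ?_
      have h1 := maximalIdeal_height_eq_ringKrullDim (R := R)
      rw [h, Ideal.height_bot, hdim] at h1
      exact absurd (WithBot.coe_injective h1 : (0 : ℕ∞) = 2) (by norm_num)
    refine ⟨_, (hmax (C r)).2 (Ideal.mem_map_of_mem C hr), fun h ↦ hr0 ?_⟩
    simpa using congrArg Subtype.val h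
  refine ⟨fun hV ↦ ?_, fun ⟨h, hzV, htr⟩ ↦ ?_⟩
  · have h : Dominates R V :=
      dominates_of_valuation_lt_one (fun r ↦ hV.algebraMap_mem ⟨_, hRB r⟩) fun r hr ↦ by
        have hlt := hV.valuation_lt_one ((hmax (C r)).2 (Ideal.mem_map_of_mem C hr))
        change V.valuation (aeval z (C r)) < 1 at hlt
        rwa [aeval_C] at hlt
    have hzV : aeval z (X : R[X]) ∈ V := hV.algebraMap_mem ⟨_, hmem X⟩
    rw [aeval_X] at hzV
    refine ⟨h, hzV, ?_⟩
    rw [h.transcendental_residue_iff]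
    intro f
    refine ⟨fun hf ↦ ?_, fun hf ↦ hV.valuation_lt_one ((hmax f).2 hf)⟩
    by_contra hfM
    have hu := (not_not.1 (mt (hmax f).1 hfM)).map (toValuationRing V hV.algebraMap_mem)
    exact (V.valuation_lt_one_iff _).2 hf hu
  · rw [h.transcendental_residue_iff] at htr
    -- Denominators outside M have value 1, so the value of an element of B is that of its
    -- numerator.
    have hone (f : R[X]) (hf : f ∉ M) : V.valuation (aeval z f) = 1 :=
      ((V.valuation_le_one_iff _).2 (h.aeval_mem hzV f)).antisymm
        (not_lt.1 fun hlt ↦ hf ((htr f).1 hlt))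
    have hval (b : B) : ∃ f : R[X], V.valuation (b : F) = V.valuation (aeval z f) ∧
        (b ∈ maximalIdeal B → f ∈ M) := by
      obtain ⟨b, w, rfl⟩ := b
      obtain ⟨f, g, rfl⟩ := IsLocalization.exists_mk'_eq M.primeCompl w
      have hw : aeval z (g : R[X]) * Φ (IsLocalization.mk' L f g) = aeval z f := by
        rw [← hΦ, ← hΦ, ← map_mul, IsLocalization.mk'_spec']
      refine ⟨f, ?_, fun hb ↦ (hmax f).1 ?_⟩
      · rw [← hw, map_mul, hone _ g.2, one_mul]
      · have := Ideal.mul_mem_left _ (⟨_, hmem g⟩ : B) hb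
        rwa [show (⟨_, hmem g⟩ : B) * ⟨Φ (IsLocalization.mk' L f g), _, rfl⟩ = ⟨_, hmem f⟩ from
          Subtype.ext hw] at this
    refine dominates_of_valuation_lt_one (fun b ↦ ?_) fun b hb ↦ ?_
    · obtain ⟨f, hf, -⟩ := hval b
      rw [← V.valuation_le_one_iff]
      exact hf.trans_le ((V.valuation_le_one_iff _).2 (h.aeval_mem hzV f))
    · obtain ⟨f, hf, hfM⟩ := hval b
      exact hf.trans_lt ((htr f).2 (hfM hb))

/-- An element of `R` or the inverse of one has algebraic residues. -/
theorem IsDicriticalDivisor.notMem_range {R F : Type*} [CommRing R] [IsLocalRing R] [Field F]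
    [Algebra R F] {z : F} {V : ValuationSubring F} (h : IsDicriticalDivisor R z V) :
    z ∉ (algebraMap R F).range ∧ z⁻¹ ∉ (algebraMap R F).range := by
  have hV := h.isPrimeDivisor.dominates
  have htr := (hV.transcendental_residue_iff h.mem).1 h.transcendental_residue
  have hz0 : z ≠ 0 := by
    rintro rfl
    have := (htr X).1 (by simp)
    rw [mem_map_C_maximalIdeal_iff, map_X] at this
    exact X_ne_zero this
  constructor
  · rintro ⟨r, hr⟩
    have := (htr (X - C r)).1 (by simp [hr])
    rw [mem_map_C_maximalIdeal_iff, Polynomial.map_sub, map_X, map_C] at this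
    exact X_sub_C_ne_zero _ this
  · rintro ⟨r, hr⟩
    have := (htr (C r * X - 1)).1 (by simp [hr, hz0])
    rw [mem_map_C_maximalIdeal_iff] at this
    simpa using congrArg (coeff · 0) this

end Dicritical

/-! ### Finiteness and existence of dicritical divisors -/

theorem mainTheorem3 {R : Type*} [CommRing R] [IsRegularLocalRing R] (hdim : ringKrullDim R = 2)
    {F : Type*} [Field F] [Algebra R F] [IsFractionRing R F] (z : F) (hz : z ≠ 0) :
    {V : ValuationSubring F | Dicritical.IsDicriticalDivisor R z V}.Finite ∧
      ({V : ValuationSubring F | Dicritical.IsDicriticalDivisor R z V}.ncard = 0 ↔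
        (z ∈ (algebraMap R F).range ∨ 1 / z ∈ (algebraMap R F).range)) := by
  rw [one_div]
  by_cases hmem : z ∈ (algebraMap R F).range ∨ z⁻¹ ∈ (algebraMap R F).range
  · have hempty : {V : ValuationSubring F | Dicritical.IsDicriticalDivisor R z V} = ∅ :=
      Set.eq_empty_of_forall_notMem fun V hV ↦ not_or.2 hV.notMem_range hmem
    rw [hempty]
    exact ⟨Set.finite_empty, iff_of_true (Set.ncard_empty _) hmem⟩
  have : IsDomain R := IsDomain.of_faithfulSMul R F
  have := Dicritical.uniqueFactorizationMonoid_of_ringKrullDim_eq_two hdim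
  obtain ⟨B, _, _, _, _, ⟨b, hb, hb0⟩, hB⟩ :=
    Dicritical.exists_subring_dominates_iff hdim (not_or.1 hmem).1 (not_or.1 hmem).2
  have hset : {V : ValuationSubring F | Dicritical.IsDicriticalDivisor R z V} =
      {V | Dicritical.Dominates B V} := by
    ext V
    refine ⟨fun hV ↦ (hB V).2 ⟨_, hV.mem, hV.transcendental_residue⟩, fun hV ↦ ?_⟩
    obtain ⟨h, hzV, htr⟩ := (hB V).1 hV
    let := (Dicritical.residueMap V h).toAlgebra
    exact ⟨⟨hV.isDiscreteValuationRing hb hb0, h, ⟨_, htr⟩⟩, hzV, htr⟩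
  have hfin := Dicritical.finite_setOf_dominates (F := F) hb hb0
  rw [hset, Set.ncard_eq_zero hfin]
  refine ⟨hfin, iff_of_false (Set.Nonempty.ne_empty ?_) hmem⟩
  -- A valuation ring dominating B exists, and it is dicritical by `hset`.
  obtain ⟨V, hle, hV⟩ := (⟨B⟩ : LocalSubring F).exists_le_valuationSubring
  exact ⟨V, fun r ↦ hle r.2, hV⟩
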